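/- Let $k \ge 1$ be an integer. Let $\mathrm{P}\Gamma_N$ be the image in $\mathrm{PSL}_2(\mathbb{Z})$ of the principal congruence subgroup $\Gamma_N \subseteq \mathrm{SL}_2(\mathbb{Z})$ of level $N$, and let $x$ and $y$ be the classes of $\begin{pmatrix}1&2\\0&1\end{pmatrix}$ and $\begin{pmatrix}1&0\\2&1\end{pmatrix}$ in the group $\mathrm{P}\Gamma_2/\mathrm{P}\Gamma_6$ (of order 12). Let $X$ be the origami (square-tiled surface) with the 48 unit squares $(A,h)$, $A \in \mathrm{P}\Gamma_2/\mathrm{P}\Gamma_6$, $h \in \{1,2,3,4\}$, in which the right neighbour $r$ and the upper neighbour $u$ of a square are $$r:\quad (A,1)\mapsto(A,2),\quad (A,2)\mapsto(Ay^{-1},1),\quad (A,3)\mapsto(A,4),\quad (A,4)\mapsto(Ay,3),$$ $$u:\quad (A,1)\mapsto(Ay,3),\quad (A,2)\mapsto(Ay^{-1},4),\quad (A,3)\mapsto(Ax^{-1},1),\quad (A,4)\mapsto(Ax,2).$$ Let $Y = Y_k$ be the following origami, a $2k$-fold cyclic cover of $X$. Its squares are $(A,h,j)$ with $(A,h)$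 a square of $X$ and $j \in \mathbb{Z}/2k\mathbb{Z}$. The right neighbour of $(A,h,j)$ is $(r(A,h),\, j+d(A,h))$ and its upper neighbour is $(u(A,h),\, j)$, where $$d = +1 \text{ on } (y^{-1}x,3),\ (y^{-1},1),\ (y,3),\ (yx^{-1},1),\qquad d = -1 \text{ on } (y^{-1}x,1),\ (y^{-1},3),\ (y,1),\ (yx^{-1},3),$$ and $d = 0$ on all other squares. (The surface $Y$ is closed and connected, of genus $24k+1$.) Endow $Y$ with the translation structure pulled back from $\mathbb{R}^2/\mathbb{Z}^2$. **Proposition.** The Veech group of $Y$, i.e. the group of derivatives of all orientation preserving affine homeomorphisms of $Y$, is $\mathrm{SL}_2(\mathbb{Z})$. -/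

import Mathlib

open scoped Topology MatrixGroups

noncomputable section

/-- Gluing data of a square-tiled surface: finitely many unit squares, the right edge of `s` being
glued to the left edge of `right s`, and the upper edge of `s` to the lower edge of `up s`. -/
structure SquareTiling where
  Square : Type
  finite : Finite Square
  right : Equiv.Perm Square
  up : Equiv.Perm Square

namespace SquareTiling

variable (O : SquareTiling)

/-- The disjoint union of the closed unit squares. -/
abbrev Pieces : Type := Σ _ : O.Square, unitInterval × unitInterval

/-- The elementary edge identifications. -/
inductive Glue : O.Pieces → O.Pieces → Prop
  | right (s : O.Square) (t : unitInterval) : Glue ⟨s, (1, t)⟩ ⟨O.right s, (0, t)⟩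
  | up (s : O.Square) (t : unitInterval) : Glue ⟨s, (t, 1)⟩ ⟨O.up s, (t, 0)⟩

/-- The surface obtained from the squares by gluing their edges, with the quotient topology
(`Quot` takes the generated equivalence relation). -/
def Surface : Type := Quot O.Glue

instance : TopologicalSpace O.Surface := inferInstanceAs (TopologicalSpace (Quot O.Glue))

/-- The covering of the torus `ℝ² / ℤ²` that maps every square onto the unit square,
ramified at most over the origin. -/
def toTorus : O.Surface → Fin 2 → UnitAddCircle :=
  Quot.lift (fun z i => (((![z.2.1, z.2.2] i : unitInterval) : ℝ) : UnitAddCircle)) (by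
    have h : ((1 : ℝ) : UnitAddCircle) = ((0 : ℝ) : UnitAddCircle) := by
      rw [AddCircle.coe_period]; rfl
    rintro _ _ (⟨s, t⟩ | ⟨s, t⟩) <;> funext i <;> fin_cases i <;> simp)

/-- The charts of the translation structure pulled back from `ℝ² / ℤ²`: the homeomorphisms from an
open subset of the surface to an open subset of `ℝ²` that lift the covering of the torus. -/
def IsTranslationChart (φ : OpenPartialHomeomorph O.Surface (Fin 2 → ℝ)) : Prop :=
  ∀ x ∈ φ.source, (fun i => (φ x i : UnitAddCircle)) = O.toTorus x

/-- The regular points are those around which there is a translation chart;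
the other points are the cone point singularities (cone angle `2πm` with `m ≥ 2`). -/
def IsRegular (x : O.Surface) : Prop :=
  ∃ φ, O.IsTranslationChart φ ∧ x ∈ φ.source

/-- `f` is an affine homeomorphism with derivative `A`: it preserves the set of singularities and
its complement, and in translation charts it is locally of the form `v ↦ A v + b`. -/
def IsAffineWithDerivative (f : O.Surface ≃ₜ O.Surface) (A : Matrix (Fin 2) (Fin 2) ℝ) : Prop :=
  (∀ x, O.IsRegular (f x) ↔ O.IsRegular x) ∧
    ∀ φ ψ, O.IsTranslationChart φ → O.IsTranslationChart ψ →
      ∀ x₀ ∈ φ.source, f x₀ ∈ ψ.source →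
        ∃ b : Fin 2 → ℝ, ∀ᶠ x in 𝓝 x₀, ψ (f x) = A.mulVec (φ x) + b

variable {O}

theorem IsTranslationChart.eventually_eq_add
    {φ ψ : OpenPartialHomeomorph O.Surface (Fin 2 → ℝ)}
    (hφ : O.IsTranslationChart φ) (hψ : O.IsTranslationChart ψ)
    {x₀ : O.Surface} (h₁ : x₀ ∈ φ.source) (h₂ : x₀ ∈ ψ.source) :
    ∃ b : Fin 2 → ℝ, ∀ᶠ x in 𝓝 x₀, ψ x = φ x + b := by
  refine ⟨ψ x₀ - φ x₀, ?_⟩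
  have hc : ContinuousAt (fun x => ψ x - φ x) x₀ :=
    (ψ.continuousAt h₂).sub (φ.continuousAt h₁)
  have hball := hc.eventually (Metric.ball_mem_nhds _ (zero_lt_one (α := ℝ)))
  filter_upwards [hball, φ.open_source.mem_nhds h₁, ψ.open_source.mem_nhds h₂] with x hx hx1 hx2
  have key : ∀ y ∈ φ.source, y ∈ ψ.source → ∀ i, ∃ n : ℤ, (n : ℝ) = ψ y i - φ y i := by
    intro y h1 h2 i
    have h := (congrFun ((hψ y h2).trans (hφ y h1).symm) i)
    have h' : ((ψ y i - φ y i : ℝ) : UnitAddCircle) = 0 := by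
      rw [AddCircle.coe_sub]; exact sub_eq_zero.2 h
    obtain ⟨n, hn⟩ := (AddCircle.coe_eq_zero_iff (1 : ℝ)).1 h'
    exact ⟨n, by simpa using hn⟩
  funext i
  obtain ⟨n, hn⟩ := key x hx1 hx2 i
  obtain ⟨m, hm⟩ := key x₀ h₁ h₂ i
  have hd : dist (ψ x i - φ x i) (ψ x₀ i - φ x₀ i) < 1 :=
    lt_of_le_of_lt (dist_le_pi_dist (ψ x - φ x) (ψ x₀ - φ x₀) i) hx
  rw [← hn, ← hm, Real.dist_eq] at hd
  have : n = m := by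
    have h3 : |n - m| < 1 := by exact_mod_cast hd
    have := Int.abs_lt_one_iff.1 h3
    omega
  subst this
  simp only [Pi.add_apply, Pi.sub_apply]
  linarith

variable (O)

/-- The Veech group: the group of derivatives of the orientation preserving affine
homeomorphisms, as a subgroup of `GL₂(ℝ)`. -/
def veechGroup : Subgroup (GL (Fin 2) ℝ) where
  carrier := {A | 0 < (A : Matrix (Fin 2) (Fin 2) ℝ).det ∧
    ∃ f : O.Surface ≃ₜ O.Surface, O.IsAffineWithDerivative f A}
  one_mem' := by
    refine ⟨by simp, Homeomorph.refl _, fun x => Iff.rfl, fun φ ψ hφ hψ x₀ h₁ h₂ => ?_⟩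
    simpa using hφ.eventually_eq_add hψ h₁ h₂
  mul_mem' := by
    rintro A B ⟨hA, f, hf, hf'⟩ ⟨hB, g, hg, hg'⟩
    refine ⟨by simpa using mul_pos hA hB, g.trans f,
      fun x => (hf (g x)).trans (hg x), fun φ ψ hφ hψ x₀ h₁ h₂ => ?_⟩
    obtain ⟨χ, hχ, h₃⟩ := (hg x₀).2 ⟨φ, hφ, h₁⟩
    obtain ⟨b, hb⟩ := hg' φ χ hφ hχ x₀ h₁ h₃
    obtain ⟨c, hc⟩ := hf' χ ψ hχ hψ (g x₀) h₃ h₂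
    refine ⟨(A : Matrix (Fin 2) (Fin 2) ℝ).mulVec b + c, ?_⟩
    filter_upwards [hb, g.continuous.continuousAt.eventually hc] with x h h'
    simp only [Homeomorph.trans_apply, Units.val_mul]
    rw [h', h, Matrix.mulVec_add, Matrix.mulVec_mulVec, add_assoc]
  inv_mem' := by
    rintro A ⟨hA, f, hf, hf'⟩
    refine ⟨?_, f.symm, fun x => by simpa using (hf (f.symm x)).symm,
      fun φ ψ hφ hψ x₀ h₁ h₂ => ?_⟩
    · rw [Matrix.coe_units_inv, Matrix.det_nonsing_inv, Ring.inverse_eq_inv']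
      exact inv_pos.2 hA
    · obtain ⟨b, hb⟩ := hf' ψ φ hψ hφ (f.symm x₀) h₂ (by simpa using h₁)
      refine ⟨-((A⁻¹ : GL (Fin 2) ℝ) : Matrix (Fin 2) (Fin 2) ℝ).mulVec b, ?_⟩
      filter_upwards [f.symm.continuous.continuousAt.eventually hb] with x h
      rw [Homeomorph.apply_symm_apply] at h
      rw [h, Matrix.mulVec_add, Matrix.mulVec_mulVec, ← Units.val_mul, inv_mul_cancel,
        Units.val_one, Matrix.one_mulVec, add_neg_cancel_right]

/-- The cyclic cover made of `n` copies of the tiling indexed by `ℤ/n`: the right edge of the copy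
`(s, j)` of the square `s` is glued to `(right s, j + d s)`; the upper edges stay in their copy. -/
def cyclicCover (n : ℕ) [NeZero n] (d : O.Square → ℤ) : SquareTiling where
  Square := O.Square × ZMod n
  finite := by
    have := O.finite
    infer_instance
  right :=
    { toFun := fun s => (O.right s.1, s.2 + (d s.1 : ZMod n))
      invFun := fun s => (O.right.symm s.1, s.2 - (d (O.right.symm s.1) : ZMod n))
      left_inv := fun s => by simp
      right_inv := fun s => by simp }
  up := O.up.prodCongr (Equiv.refl _)

end SquareTiling

/-- `PΓ_N`, the image in `PSL₂(ℤ)` of the principal congruence subgroup of level `N`. -/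
def PGamma (N : ℕ) : Subgroup PSL(2, ℤ) :=
  (CongruenceSubgroup.Gamma N).map (QuotientGroup.mk' _)

instance (N : ℕ) : (PGamma N).Normal :=
  Subgroup.Normal.map (CongruenceSubgroup.Gamma_normal N) _ (QuotientGroup.mk'_surjective _)

/-- The quotient group `PΓ₂ / PΓ₆`. -/
abbrev PGammaQuot : Type := PGamma 2 ⧸ (PGamma 6).subgroupOf (PGamma 2)

/-- `x = T²`. -/
def xMat : SL(2, ℤ) := ⟨!![1, 2; 0, 1], by simp⟩

/-- `y = L²`. -/
def yMat : SL(2, ℤ) := ⟨!![1, 0; 2, 1], by simp⟩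

theorem xMat_mem : xMat ∈ CongruenceSubgroup.Gamma 2 := by
  rw [CongruenceSubgroup.Gamma_mem]; decide

theorem yMat_mem : yMat ∈ CongruenceSubgroup.Gamma 2 := by
  rw [CongruenceSubgroup.Gamma_mem]; decide

/-- The class of `x` in `PΓ₂ / PΓ₆`. -/
def xQ : PGammaQuot :=
  QuotientGroup.mk ⟨QuotientGroup.mk' _ xMat, Subgroup.mem_map_of_mem _ xMat_mem⟩

/-- The class of `y` in `PΓ₂ / PΓ₆`. -/
def yQ : PGammaQuot :=
  QuotientGroup.mk ⟨QuotientGroup.mk' _ yMat, Subgroup.mem_map_of_mem _ yMat_mem⟩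

theorem finite_PGammaQuot : Finite PGammaQuot := by
  have : (PGamma 6).FiniteIndex :=
    ⟨fun h => (inferInstance : (CongruenceSubgroup.Gamma 6).FiniteIndex).index_ne_zero
      (Nat.eq_zero_of_zero_dvd (h ▸ Subgroup.index_map_dvd (CongruenceSubgroup.Gamma 6)
        (QuotientGroup.mk'_surjective (Subgroup.center SL(2, ℤ)))))⟩
  infer_instance

/-- The origami `X` of 48 squares. The square `(A, h)` with `h ∈ {1, 2, 3, 4}` is
`(A, h - 1)` here, with second entry in `Fin 4 = {0, 1, 2, 3}`. -/
def origamiX : SquareTiling where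
  Square := PGammaQuot × Fin 4
  finite := by
    have := finite_PGammaQuot
    infer_instance
  right :=
    { toFun := fun s => match s with
        | (A, 0) => (A, 1)
        | (A, 1) => (A * yQ⁻¹, 0)
        | (A, 2) => (A, 3)
        | (A, 3) => (A * yQ, 2)
      invFun := fun s => match s with
        | (A, 0) => (A * yQ, 1)
        | (A, 1) => (A, 0)
        | (A, 2) => (A * yQ⁻¹, 3)
        | (A, 3) => (A, 2)
      left_inv := by rintro ⟨A, h⟩; fin_cases h <;> simp
      right_inv := by rintro ⟨A, h⟩; fin_cases h <;> simp }
  up :=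
    { toFun := fun s => match s with
        | (A, 0) => (A * yQ, 2)
        | (A, 1) => (A * yQ⁻¹, 3)
        | (A, 2) => (A * xQ⁻¹, 0)
        | (A, 3) => (A * xQ, 1)
      invFun := fun s => match s with
        | (A, 0) => (A * xQ, 2)
        | (A, 1) => (A * xQ⁻¹, 3)
        | (A, 2) => (A * yQ⁻¹, 0)
        | (A, 3) => (A * yQ, 1)
      left_inv := by rintro ⟨A, h⟩; fin_cases h <;> simp
      right_inv := by rintro ⟨A, h⟩; fin_cases h <;> simp }

open Classical in
/-- The slits: the change of the copy when the right edge of a square of `X` is crossed.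
It is `1` at the slits with an arrow pointing upwards, `-1` at those with an arrow pointing
downwards, and `0` at all other vertical edges. With `A₄ = y⁻¹x`, `A₅ = y⁻¹`, `A₆ = y`,
`A₇ = yx⁻¹`, the squares on the left of a slit are the `(A_i, 1)` and `(A_i, 3)`, `4 ≤ i ≤ 7`. -/
def slitDrift (s : PGammaQuot × Fin 4) : ℤ :=
  if s = (yQ⁻¹ * xQ, 2) ∨ s = (yQ⁻¹, 0) ∨ s = (yQ, 2) ∨ s = (yQ * xQ⁻¹, 0) then 1
  else if s = (yQ⁻¹ * xQ, 0) ∨ s = (yQ⁻¹, 2) ∨ s = (yQ, 0) ∨ s = (yQ * xQ⁻¹, 2) then -1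
  else 0

/-- The origami `Y`: `2k` copies of `X`, slit and cyclically reglued. -/
def origamiY (k : ℕ) [NeZero k] : SquareTiling :=
  origamiX.cyclicCover (2 * k) slitDrift

end

/-!
If `T` and `S` are the derivatives of affine homeomorphisms of a square-tiled surface, its Veech
group contains `SL₂(ℤ)`. On `X` these homeomorphisms permute the squares by right multiplications,
which is compatible with the gluing because `x³ = y³ = (xy)² = 1`. They lift to the cyclic cover `Y`
because the drift has the form `± (p A - p (A x⁻¹))` for a function `p` with `p (A x⁻¹) = p (A y)`;
the lifts invert the deck transformations.

Conversely, an affine homeomorphism preserves the singularities, which lie over the origin of the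
torus. A horizontal and a vertical unit edge between singularities therefore have images whose
holonomy is an integer vector, so that the derivative is an integer matrix, and so is its inverse.
-/

noncomputable section

open Set Filter Topology
open scoped Matrix.Module commutatorElement

/-! ### The torus -/

section Torus

variable {ι : Type*}

/-- The projection of the vector space `ℝ^ι` onto the torus `ℝ^ι / ℤ^ι`. -/
def torusMk : (ι → ℝ) →+ (ι → UnitAddCircle) :=
  (QuotientAddGroup.mk' (AddSubgroup.zmultiples (1 : ℝ))).compLeft ι

theorem torusMk_apply (v : ι → ℝ) (i : ι) : torusMk v i = (v i : UnitAddCircle) := rfl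

theorem continuous_torusMk : Continuous (torusMk : (ι → ℝ) → ι → UnitAddCircle) :=
  continuous_pi fun i => (AddCircle.continuous_mk' 1).comp (continuous_apply i)

theorem torusMk_eq_zero_iff {v : ι → ℝ} : torusMk v = 0 ↔ ∀ i, ∃ n : ℤ, (n : ℝ) = v i := by
  simp only [funext_iff, torusMk_apply, Pi.zero_apply, AddCircle.coe_eq_zero_iff, zsmul_one]

theorem eq_zero_of_torusMk_eq_zero {v : ι → ℝ} (h : torusMk v = 0) (hv : ∀ i, |v i| < 1) :
    v = 0 := by
  funext i
  obtain ⟨n, hn⟩ := torusMk_eq_zero_iff.1 h i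
  have hn0 : n = 0 := Int.abs_lt_one_iff.1 (by exact_mod_cast hn ▸ hv i)
  rw [← hn, hn0, Int.cast_zero, Pi.zero_apply]

theorem exists_eq_map_intCast_of_torusMk_col_eq_zero {κ : Type*} {A : Matrix ι κ ℝ}
    (hA : ∀ j, torusMk (A.col j) = 0) :
    ∃ M : Matrix ι κ ℤ, A = M.map Int.cast := by
  choose M hM using fun j => torusMk_eq_zero_iff.1 (hA j)
  exact ⟨Matrix.of fun i j => M j i, Matrix.ext fun i j => (hM j i).symm⟩

theorem torusMk_mulVec [Fintype ι] [DecidableEq ι] (M : Matrix ι ι ℤ) (v : ι → ℝ) :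
    torusMk ((M.map Int.cast).mulVec v) = M • torusMk v := by
  funext i
  have hsum : torusMk ((M.map Int.cast).mulVec v) i =
      ∑ j, (((M i j : ℝ) * v j : ℝ) : UnitAddCircle) :=
    map_sum (QuotientAddGroup.mk' (AddSubgroup.zmultiples (1 : ℝ))) _ _
  simp only [hsum, Matrix.Module.smul_apply, torusMk_apply, ← zsmul_eq_mul, AddCircle.coe_zsmul]

variable [Finite ι] {α : Type*} [TopologicalSpace α] {g h : α → ι → ℝ} {x₀ : α}

theorem eventuallyEq_of_torusMk_eq (hg : ContinuousAt g x₀) (hh : ContinuousAt h x₀)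
    (hgh : ∀ᶠ x in 𝓝 x₀, torusMk (g x) = torusMk (h x)) (h₀ : g x₀ = h x₀) : g =ᶠ[𝓝 x₀] h := by
  have hsmall : ∀ᶠ x in 𝓝 x₀, ∀ i, |(g x - h x) i| < 1 :=
    eventually_all.2 fun i =>
      (continuous_abs.continuousAt.comp (continuousAt_pi.1 (hg.sub hh) i)).eventually
        (gt_mem_nhds (by simp [h₀]))
  filter_upwards [hgh, hsmall] with x hx hlt
  exact sub_eq_zero.1 (eq_zero_of_torusMk_eq_zero (by rw [map_sub, hx, sub_self]) hlt)

theorem exists_eventuallyEq_add_of_torusMk_eq (hg : ContinuousAt g x₀) (hh : ContinuousAt h x₀)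
    (hgh : ∀ᶠ x in 𝓝 x₀, torusMk (g x) = torusMk (h x)) :
    ∃ b, ∀ᶠ x in 𝓝 x₀, g x = h x + b := by
  refine ⟨g x₀ - h x₀, eventuallyEq_of_torusMk_eq hg (hh.add continuousAt_const) ?_ (by simp)⟩
  filter_upwards [hgh] with x hx
  rw [map_add, map_sub, hgh.self_of_nhds, sub_self, add_zero, hx]

end Torus

theorem mem_range_mapGL_of_eq_map_intCast {n : Type*} [Fintype n] [DecidableEq n] {A : GL n ℝ}
    {M N : Matrix n n ℤ} (hM : (A : Matrix n n ℝ) = M.map Int.cast)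
    (hN : ((A⁻¹ : GL n ℝ) : Matrix n n ℝ) = N.map Int.cast) (hpos : 0 < (A : Matrix n n ℝ).det) :
    A ∈ (Matrix.SpecialLinearGroup.mapGL ℝ : Matrix.SpecialLinearGroup n ℤ →* GL n ℝ).range := by
  have hdet (P : Matrix n n ℤ) : (P.map (Int.cast : ℤ → ℝ)).det = P.det := (Int.cast_det P).symm
  have hmul : (M.det : ℝ) * N.det = 1 := by
    rw [← hdet, ← hdet, ← hM, ← hN, ← Matrix.det_mul, A.mul_inv, Matrix.det_one]
  rw [hM, hdet] at hpos
  have hM1 : M.det = 1 :=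
    Int.eq_one_of_mul_eq_one_right (by exact_mod_cast hpos.le) (by exact_mod_cast hmul)
  exact ⟨⟨M, hM1⟩, Units.ext hM.symm⟩

/-! ### Coordinates on the surface -/

namespace SquareTiling

variable (O : SquareTiling)

/-- The point with coordinates `(x, y)` of the square `s`; the coordinates are clamped to
`[0, 1]`. -/
def pt (s : O.Square) (x y : ℝ) : O.Surface :=
  Quot.mk _ ⟨s, (projIcc 0 1 zero_le_one x, projIcc 0 1 zero_le_one y)⟩

theorem pt_right (s : O.Square) (y : ℝ) : O.pt s 1 y = O.pt (O.right s) 0 y := by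
  simp only [pt, projIcc_right, projIcc_left]
  exact Quot.sound (Glue.right s _)

theorem pt_up (s : O.Square) (x : ℝ) : O.pt s x 1 = O.pt (O.up s) x 0 := by
  simp only [pt, projIcc_right, projIcc_left]
  exact Quot.sound (Glue.up s _)

theorem mk_eq_pt (s : O.Square) (p : unitInterval × unitInterval) :
    (Quot.mk _ ⟨s, p⟩ : O.Surface) = O.pt s p.1 p.2 := by
  simp only [pt, projIcc_val]

theorem exists_eq_pt (z : O.Surface) :
    ∃ s, ∃ x ∈ Icc (0 : ℝ) 1, ∃ y ∈ Icc (0 : ℝ) 1, z = O.pt s x y := by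
  obtain ⟨⟨s, p⟩, rfl⟩ := Quot.exists_rep z
  exact ⟨s, _, p.1.2, _, p.2.2, O.mk_eq_pt s p⟩

theorem isOpen_iff_pt {U : Set O.Surface} :
    IsOpen U ↔ ∀ s, IsOpen {p : unitInterval × unitInterval | O.pt s p.1 p.2 ∈ U} := by
  simp only [← mk_eq_pt]
  exact (isQuotientMap_quot_mk (r := O.Glue)).isOpen_preimage.symm.trans isOpen_sigma_iff

theorem continuous_pt (s : O.Square) : Continuous fun p : ℝ × ℝ => O.pt s p.1 p.2 :=
  continuous_quot_mk.comp ((continuous_sigmaMk (σ := fun _ : O.Square => _)).comp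
    ((continuous_projIcc.comp continuous_fst).prodMk (continuous_projIcc.comp continuous_snd)))

theorem toTorus_pt (s : O.Square) {x y : ℝ} (hx : x ∈ Icc (0 : ℝ) 1) (hy : y ∈ Icc (0 : ℝ) 1) :
    O.toTorus (O.pt s x y) = torusMk ![x, y] := by
  funext i
  fin_cases i <;> simp [toTorus, pt, torusMk_apply, projIcc_of_mem, hx, hy]

theorem continuous_toTorus : Continuous O.toTorus := by
  refine continuous_quot_lift _ (continuous_sigma fun s => continuous_pi fun i => ?_)
  refine (AddCircle.continuous_mk' 1).comp (continuous_subtype_val.comp ?_)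
  fin_cases i
  exacts [continuous_fst, continuous_snd]

section Lift

variable {O} {α : Type*} (F : O.Square → ℝ → ℝ → α)
  (hr : ∀ s, ∀ y ∈ Icc (0 : ℝ) 1, F s 1 y = F (O.right s) 0 y)
  (hu : ∀ s, ∀ x ∈ Icc (0 : ℝ) 1, F s x 1 = F (O.up s) x 0)

/-- The map on the surface given by a family of maps on the squares that are compatible with the
gluing. -/
def lift : O.Surface → α :=
  Quot.lift (fun z => F z.1 z.2.1 z.2.2) (by
    rintro _ _ (⟨s, t⟩ | ⟨s, t⟩)
    exacts [hr s t t.2, hu s t t.2])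

theorem lift_pt (s : O.Square) {x y : ℝ} (hx : x ∈ Icc (0 : ℝ) 1) (hy : y ∈ Icc (0 : ℝ) 1) :
    lift F hr hu (O.pt s x y) = F s x y := by
  simp only [lift, pt, projIcc_of_mem _ hx, projIcc_of_mem _ hy]

theorem continuous_lift [TopologicalSpace α]
    (hF : ∀ s, Continuous fun p : ℝ × ℝ => F s p.1 p.2) : Continuous (lift F hr hu) :=
  continuous_quot_lift _ (continuous_sigma fun s => (hF s).comp
    (f := fun p : unitInterval × unitInterval => ((p.1 : ℝ), (p.2 : ℝ))) (by fun_prop))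

end Lift

theorem eq_of_pt_eq_pt {s s' : O.Square} {x y x' y' : ℝ} (hx : x ∈ Ioo (0 : ℝ) 1)
    (hy : y ∈ Ioo (0 : ℝ) 1) (hx' : x' ∈ Icc (0 : ℝ) 1) (hy' : y' ∈ Icc (0 : ℝ) 1)
    (h : O.pt s x y = O.pt s' x' y') : s' = s := by
  let inInterior (q : O.Square) (a b : ℝ) : Prop := q = s ∧ a ∈ Ioo (0 : ℝ) 1 ∧ b ∈ Ioo (0 : ℝ) 1
  have hr : ∀ q, ∀ b ∈ Icc (0 : ℝ) 1, inInterior q 1 b = inInterior (O.right q) 0 b := by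
    simp [inInterior]
  have hu : ∀ q, ∀ a ∈ Icc (0 : ℝ) 1, inInterior q a 1 = inInterior (O.up q) a 0 := by
    simp [inInterior]
  have hlift := congrArg (lift inInterior hr hu) h
  rw [lift_pt _ _ _ _ (Ioo_subset_Icc_self hx) (Ioo_subset_Icc_self hy), lift_pt _ _ _ _ hx' hy']
    at hlift
  exact (hlift.mp ⟨rfl, hx, hy⟩).1

section Strip

/-- The point with coordinates `(x, y)` of the rectangle `[0, 2] × [0, 1]` formed by the square `s`
and its right neighbour. -/
def strip (s : O.Square) (x y : ℝ) : O.Surface :=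
  if x ≤ 1 then O.pt s x y else O.pt (O.right s) (x - 1) y

variable {O}

theorem strip_of_le {s : O.Square} {x y : ℝ} (h : x ≤ 1) : O.strip s x y = O.pt s x y := if_pos h

theorem strip_of_ge {s : O.Square} {x y : ℝ} (h : 1 ≤ x) :
    O.strip s x y = O.pt (O.right s) (x - 1) y := by
  rcases h.eq_or_lt with rfl | h
  · rw [strip_of_le le_rfl, pt_right, sub_self]
  · exact if_neg h.not_ge

variable (O)

theorem continuous_strip (s : O.Square) : Continuous fun p : ℝ × ℝ => O.strip s p.1 p.2 := by
  refine Continuous.if_le (O.continuous_pt s)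
    ((O.continuous_pt (O.right s)).comp (f := fun p : ℝ × ℝ => (p.1 - 1, p.2)) (by fun_prop))
    continuous_fst continuous_const fun p hp => ?_
  rw [hp, sub_self, pt_right]

theorem toTorus_strip (s : O.Square) {x y : ℝ} (hx : x ∈ Icc (0 : ℝ) 2)
    (hy : y ∈ Icc (0 : ℝ) 1) : O.toTorus (O.strip s x y) = torusMk ![x, y] := by
  rcases le_total x 1 with h | h
  · rw [strip_of_le h, toTorus_pt _ _ ⟨hx.1, h⟩ hy]
  · rw [strip_of_ge h, toTorus_pt _ _ ⟨by linarith, by linarith [hx.2]⟩ hy]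
    funext i
    fin_cases i
    · exact (AddCircle.coe_sub 1 x 1).trans
        ((congrArg _ (AddCircle.coe_period 1)).trans (sub_zero _))
    · rfl

/-- The open unit square `(a, a + 1) × (0, 1)`; for `a ∈ [0, 1]` it lies in a strip. -/
def window (a : ℝ) : Set (Fin 2 → ℝ) := {w | w 0 ∈ Ioo a (a + 1) ∧ w 1 ∈ Ioo 0 1}

theorem isOpen_window (a : ℝ) : IsOpen (window a) :=
  (isOpen_Ioo.preimage (continuous_apply 0)).inter (isOpen_Ioo.preimage (continuous_apply 1))

/-- The condition for the point `(x, y)` of the square `q` to belong to the image of a subset `V`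
of a window of the strip at `s`. -/
def MemStripImage (s : O.Square) (V : Set (Fin 2 → ℝ)) (q : O.Square) (x y : ℝ) : Prop :=
  q = s ∧ ![x, y] ∈ V ∨ q = O.right s ∧ ![x + 1, y] ∈ V

variable {O} {s : O.Square} {a : ℝ} {V : Set (Fin 2 → ℝ)}

theorem memStripImage_right (ha : a ∈ Icc (0 : ℝ) 1) (hV : V ⊆ window a) (q : O.Square) (y : ℝ) :
    O.MemStripImage s V q 1 y ↔ O.MemStripImage s V (O.right q) 0 y := by
  have h0 : ![0, y] ∉ V := fun h => (hV h).1.1.not_ge ha.1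
  have h2 : ![1 + 1, y] ∉ V := fun h => (hV h).1.2.not_ge (add_le_add_left ha.2 1)
  simp [MemStripImage, h0, h2]

theorem memStripImage_up (hV : V ⊆ window a) (q : O.Square) (x : ℝ) :
    O.MemStripImage s V q x 1 ↔ O.MemStripImage s V (O.up q) x 0 := by
  have h0 (z : ℝ) : ![z, 0] ∉ V := fun h => (hV h).2.1.false
  have h1 (z : ℝ) : ![z, 1] ∉ V := fun h => (hV h).2.2.false
  simp [MemStripImage, h0, h1]

theorem mem_image_strip_iff (ha : a ∈ Icc (0 : ℝ) 1) (hV : V ⊆ window a) (q : O.Square) {x y : ℝ}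
    (hx : x ∈ Icc (0 : ℝ) 1) (hy : y ∈ Icc (0 : ℝ) 1) :
    O.pt q x y ∈ (fun w : Fin 2 → ℝ => O.strip s (w 0) (w 1)) '' V ↔
      O.MemStripImage s V q x y := by
  constructor
  · rintro ⟨w, hw, h⟩
    have hr : ∀ q, ∀ b ∈ Icc (0 : ℝ) 1, O.MemStripImage s V q 1 b =
        O.MemStripImage s V (O.right q) 0 b := fun q b _ => propext (memStripImage_right ha hV q b)
    have hu : ∀ q, ∀ b ∈ Icc (0 : ℝ) 1, O.MemStripImage s V q b 1 =
        O.MemStripImage s V (O.up q) b 0 := fun q b _ => propext (memStripImage_up hV q b)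
    rw [← lift_pt _ hr hu q hx hy, ← h]
    beta_reduce
    obtain ⟨⟨w0, w0'⟩, hw1⟩ := hV hw
    have hw1 := Ioo_subset_Icc_self hw1
    rw [show w = ![w 0, w 1] from List.ofFn_inj.1 rfl] at hw
    rcases le_total (w 0) 1 with h1 | h1
    · rw [strip_of_le h1, lift_pt _ hr hu _ ⟨by linarith [ha.1], h1⟩ hw1]
      exact Or.inl ⟨rfl, hw⟩
    · rw [strip_of_ge h1, lift_pt _ hr hu _ ⟨by linarith, by linarith [ha.2]⟩ hw1]
      exact Or.inr ⟨rfl, by rwa [sub_add_cancel]⟩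
  · rintro (⟨rfl, h⟩ | ⟨rfl, h⟩)
    · exact ⟨_, h, strip_of_le hx.2⟩
    · exact ⟨_, h, (strip_of_ge (le_add_of_nonneg_left hx.1)).trans
        (congrArg (O.pt _ · y) (add_sub_cancel_right x 1))⟩

theorem isOpen_image_strip (ha : a ∈ Icc (0 : ℝ) 1) (hV : V ⊆ window a) (hVo : IsOpen V)
    (s : O.Square) : IsOpen ((fun w : Fin 2 → ℝ => O.strip s (w 0) (w 1)) '' V) := by
  rw [isOpen_iff_pt]
  intro q
  simp only [mem_image_strip_iff ha hV q (Subtype.prop _) (Subtype.prop _), MemStripImage]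
  exact IsOpen.union (isOpen_const.and (hVo.preimage (by fun_prop)))
    (isOpen_const.and (hVo.preimage (by fun_prop)))

theorem toTorus_strip_of_mem_window (ha : a ∈ Icc (0 : ℝ) 1) {w : Fin 2 → ℝ} (hw : w ∈ window a)
    (s : O.Square) : O.toTorus (O.strip s (w 0) (w 1)) = torusMk w := by
  obtain ⟨⟨w0, w0'⟩, hw1⟩ := hw
  rw [toTorus_strip _ _ ⟨by linarith [ha.1], by linarith [ha.2]⟩ (Ioo_subset_Icc_self hw1)]
  congr 1
  exact List.ofFn_inj.1 rfl

theorem injOn_strip (ha : a ∈ Icc (0 : ℝ) 1) (s : O.Square) :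
    InjOn (fun w : Fin 2 → ℝ => O.strip s (w 0) (w 1)) (window a) := by
  intro w hw v hv hwv
  have htorus := congrArg O.toTorus hwv
  rw [toTorus_strip_of_mem_window ha hw, toTorus_strip_of_mem_window ha hv] at htorus
  refine sub_eq_zero.1 (eq_zero_of_torusMk_eq_zero (by rw [map_sub, htorus, sub_self]) fun i => ?_)
  obtain ⟨⟨w0, w0'⟩, w1, w1'⟩ := hw
  obtain ⟨⟨v0, v0'⟩, v1, v1'⟩ := hv
  fin_cases i <;> simp only [Fin.zero_eta, Fin.mk_one, Pi.sub_apply, abs_lt] <;>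
    constructor <;> linarith

theorem isRegular_strip (ha : a ∈ Icc (0 : ℝ) 1) (s : O.Square) {w : Fin 2 → ℝ}
    (hw : w ∈ window a) : O.IsRegular (O.strip s (w 0) (w 1)) := by
  let g : window a → O.Surface := fun w => O.strip s (w.1 0) (w.1 1)
  have hg : IsOpenEmbedding g := by
    refine .of_continuous_injective_isOpenMap ?_ ?_ ?_
    · exact (O.continuous_strip s).comp (f := fun w : window a => (w.1 0, w.1 1))
        (((continuous_apply 0).prodMk (continuous_apply 1)).comp continuous_subtype_val)
    · exact fun w v h => Subtype.ext (injOn_strip ha s w.2 v.2 h)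
    · intro V hV
      have h := isOpen_image_strip ha (Subtype.coe_image_subset _ V)
        ((isOpen_window a).isOpenMap_subtype_val V hV) s
      rwa [image_image] at h
  have : Nonempty (window a) := ⟨⟨w, hw⟩⟩
  let G := hg.toOpenPartialHomeomorph g
  let ι := (isOpen_window a).isOpenEmbedding_subtypeVal.toOpenPartialHomeomorph Subtype.val
  refine ⟨G.symm.trans ι, fun z hz => ?_, ?_⟩
  · obtain ⟨v, rfl⟩ : z ∈ range g := by simpa [G, ι] using hz
    have hv : G.symm (g v) = v := G.left_inv (mem_univ v)
    change torusMk (G.symm (g v)) = O.toTorus (g v)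
    rw [hv, toTorus_strip_of_mem_window ha v.2]
  · suffices O.strip s (w 0) (w 1) ∈ range g by simpa [G, ι] using this
    exact ⟨⟨w, hw⟩, rfl⟩

end Strip

theorem isRegular_of_snd_mem_Ioo (s : O.Square) {x y : ℝ} (hx : x ∈ Icc (0 : ℝ) 1)
    (hy : y ∈ Ioo (0 : ℝ) 1) : O.IsRegular (O.pt s x y) := by
  have right_edge (q : O.Square) : O.IsRegular (O.pt q 1 y) := by
    rw [← strip_of_le le_rfl]
    exact isRegular_strip (a := 1 / 2) (by norm_num) q (w := ![1, y]) ⟨by norm_num, hy⟩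
  rcases hx.2.eq_or_lt with rfl | hx1
  · exact right_edge s
  rcases hx.1.eq_or_lt with rfl | hx0
  · rw [← O.right.apply_symm_apply s, ← pt_right]
    exact right_edge _
  · rw [← strip_of_le hx.2]
    exact isRegular_strip (a := 0) (by norm_num) s (w := ![x, y]) ⟨by simpa using ⟨hx0, hx1⟩, hy⟩

theorem pt_commutator (s : O.Square) : O.pt (⁅O.right, O.up⁆ s) 0 0 = O.pt s 0 0 := by
  have hright := O.pt_right (O.right.symm (O.up.symm s)) 1
  have hup := O.pt_up (O.up.symm s) 0
  rw [Equiv.apply_symm_apply] at hright hup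
  simp only [commutatorElement_def, Equiv.Perm.mul_apply, Equiv.Perm.inv_def]
  rw [← pt_right, ← pt_up, hright, hup]

theorem not_isRegular_of_pt_eq {s s' : O.Square} (hne : s ≠ s') (h : O.pt s 0 0 = O.pt s' 0 0) :
    ¬ O.IsRegular (O.pt s 0 0) := by
  rintro ⟨φ, hφ, hmem⟩
  let diag (q : O.Square) (t : unitInterval) : O.Surface := O.pt q t t
  have hdiag (q) (hq : O.pt q 0 0 = O.pt s 0 0) : ContinuousAt (fun t => φ (diag q t)) 0 ∧
      ∀ᶠ t in 𝓝 0, diag q t ∈ φ.source := by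
    have hq0 : diag q 0 = O.pt s 0 0 := hq
    have hc : ContinuousAt (diag q) 0 := ((O.continuous_pt q).comp
      (f := fun t : unitInterval => ((t : ℝ), (t : ℝ))) (by fun_prop)).continuousAt
    exact ⟨(φ.continuousAt (hq0 ▸ hmem)).comp hc,
      hc.eventually (φ.open_source.mem_nhds (hq0 ▸ hmem))⟩
  obtain ⟨hφs, hs⟩ := hdiag s rfl
  obtain ⟨hφs', hs'⟩ := hdiag s' h.symm
  have heq : ∀ᶠ t in 𝓝 (0 : unitInterval), φ (diag s t) = φ (diag s' t) := by
    refine eventuallyEq_of_torusMk_eq hφs hφs' ?_ (congrArg φ h)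
    filter_upwards [hs, hs'] with t ht ht'
    exact (hφ _ ht).trans (((O.toTorus_pt s t.2 t.2).trans (O.toTorus_pt s' t.2 t.2).symm).trans
      (hφ _ ht').symm)
  have : (𝓝[>] (0 : unitInterval)).NeBot := nhdsGT_neBot_of_exists_gt ⟨1, zero_lt_one⟩
  have hgood := heq.and (hs.and (hs'.and (gt_mem_nhds zero_lt_one)))
  obtain ⟨t, ⟨ht, hts, hts', ht1⟩, ht0⟩ :=
    ((hgood.filter_mono (nhdsWithin_le_nhds (s := Ioi 0))).and self_mem_nhdsWithin).exists
  have htI : (t : ℝ) ∈ Ioo (0 : ℝ) 1 := ⟨ht0, ht1⟩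
  exact hne (O.eq_of_pt_eq_pt htI htI t.2 t.2 (φ.injOn hts hts' ht)).symm

theorem not_isRegular_of_commutator_ne {s : O.Square} (h : ⁅O.right, O.up⁆ s ≠ s) :
    ¬ O.IsRegular (O.pt s 0 0) :=
  O.not_isRegular_of_pt_eq h.symm (O.pt_commutator s).symm

end SquareTiling

/-! ### Shears and quarter turns -/

theorem eq_of_eventually_const_Ioo {X : Type*} [TopologicalSpace X] [T2Space X] {δ : ℝ → X}
    {a b : ℝ} (hab : a < b) (hδ : Continuous δ) (hloc : ∀ t ∈ Ioo a b, ∀ᶠ t' in 𝓝 t, δ t' = δ t) :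
    δ a = δ b := by
  obtain ⟨m, hm⟩ := nonempty_Ioo.2 hab
  have hconst : EqOn δ (fun _ => δ m) (Ioo a b) := fun t ht =>
    isPreconnected_Ioo.induction₂ (fun x y => δ x = δ y)
      (fun x hx => ((hloc x hx).filter_mono nhdsWithin_le_nhds).mono fun _ h => h.symm)
      (fun _ _ _ _ _ _ h h' => h.trans h') (fun _ _ _ _ h => h.symm) ht hm
  have hclosure := hconst.closure hδ continuous_const
  rw [closure_Ioo hab.ne] at hclosure
  exact (hclosure (left_mem_Icc.2 hab.le)).trans (hclosure (right_mem_Icc.2 hab.le)).symm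

namespace SquareTiling

variable {O O' : SquareTiling}

/-- The map `f` between surfaces covers the automorphism of the torus given by `g`. -/
def CoversLinear (f : O.Surface → O'.Surface) (g : SL(2, ℤ)) : Prop :=
  ∀ z, O'.toTorus (f z) = (g : Matrix (Fin 2) (Fin 2) ℤ) • O.toTorus z

namespace CoversLinear

variable {g : SL(2, ℤ)}

theorem symm {f : O.Surface ≃ₜ O'.Surface} (hf : CoversLinear f g) :
    CoversLinear f.symm g⁻¹ := fun z => by
  rw [← f.apply_symm_apply z, hf, smul_smul, ← Matrix.SpecialLinearGroup.coe_mul,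
    inv_mul_cancel, Matrix.SpecialLinearGroup.coe_one, one_smul, f.symm_apply_apply]

theorem isRegular_apply {f : O.Surface ≃ₜ O'.Surface} (hf : CoversLinear f g) {z : O.Surface}
    (hz : O.IsRegular z) : O'.IsRegular (f z) := by
  obtain ⟨φ, hφ, hzφ⟩ := hz
  let L : (Fin 2 → ℝ) ≃ₜ (Fin 2 → ℝ) :=
    (Matrix.SpecialLinearGroup.toLin' (g : SL(2, ℝ))).toContinuousLinearEquiv.toHomeomorph
  refine ⟨(f.symm.transOpenPartialHomeomorph φ).transHomeomorph L, fun w hw => ?_, ?_⟩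
  · calc torusMk ((g.1.map Int.cast).mulVec (φ (f.symm w)))
        = g.1 • torusMk (φ (f.symm w)) := torusMk_mulVec _ _
      _ = g.1 • O.toTorus (f.symm w) := congrArg _ (hφ _ hw)
      _ = O'.toTorus w := by rw [← hf, f.apply_symm_apply]
  · change f.symm (f z) ∈ φ.source
    rwa [f.symm_apply_apply]

theorem isRegular_apply_iff {f : O.Surface ≃ₜ O'.Surface} (hf : CoversLinear f g)
    {z : O.Surface} : O'.IsRegular (f z) ↔ O.IsRegular z :=
  ⟨fun h => f.symm_apply_apply z ▸ hf.symm.isRegular_apply h, hf.isRegular_apply⟩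

theorem isAffineWithDerivative {f : O.Surface ≃ₜ O.Surface} (hf : CoversLinear f g) :
    O.IsAffineWithDerivative f (g.1.map Int.cast) := by
  refine ⟨fun z => hf.isRegular_apply_iff, fun φ ψ hφ hψ z₀ hz₀ hfz₀ => ?_⟩
  refine exists_eventuallyEq_add_of_torusMk_eq
    ((ψ.continuousAt hfz₀).comp f.continuous.continuousAt)
    ((continuous_const.matrix_mulVec continuous_id).continuousAt.comp (φ.continuousAt hz₀)) ?_
  filter_upwards [φ.open_source.mem_nhds hz₀,
    f.continuous.continuousAt.eventually (ψ.open_source.mem_nhds hfz₀)] with z hz hfz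
  calc torusMk (ψ (f z)) = O.toTorus (f z) := hψ _ hfz
    _ = g.1 • torusMk (φ z) := (hf z).trans (congrArg _ (hφ _ hz).symm)
    _ = torusMk ((g.1.map Int.cast).mulVec (φ z)) := (torusMk_mulVec _ _).symm

theorem mapGL_mem_veechGroup {f : O.Surface ≃ₜ O.Surface} (hf : CoversLinear f g) :
    Matrix.SpecialLinearGroup.mapGL ℝ g ∈ O.veechGroup := by
  refine ⟨?_, f, hf.isAffineWithDerivative⟩
  change 0 < (g.1.map (Int.cast : ℤ → ℝ)).det
  rw [← Int.cast_det, g.2, Int.cast_one]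
  exact one_pos

end CoversLinear

/-- A bijection `σ` between the squares of two tilings that describes the shear
`(x, y) ↦ (x + y, y)`: the lower left half of the square `s` goes to the square `σ s` and the upper
right half to its right neighbour. -/
structure IsShear (σ : O.Square ≃ O'.Square) : Prop where
  map_right (s : O.Square) : σ (O.right s) = O'.right (σ s)
  map_up (s : O.Square) : σ (O.up s) = O'.up (O'.right (σ s))

namespace IsShear

variable {σ : O.Square ≃ O'.Square} (hσ : IsShear σ)

include hσ in
theorem symm_right (s : O'.Square) : σ.symm (O'.right s) = O.right (σ.symm s) := by
  rw [Equiv.symm_apply_eq, hσ.map_right, Equiv.apply_symm_apply]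

/-- The map `(x, y) ↦ (x + y, y)` from the square `s` to the strip at `σ s`. -/
def map : O.Surface → O'.Surface :=
  lift (fun s x y => O'.strip (σ s) (x + y) y)
    (fun s y hy => by
      rw [strip_of_ge (by linarith [hy.1]), strip_of_le (by linarith [hy.2]), hσ.map_right]
      congr 1; ring)
    (fun s x hx => by
      rw [strip_of_ge (by linarith [hx.1]), strip_of_le (by linarith [hx.2]), pt_up, hσ.map_up]
      congr 1; ring)

/-- The inverse `(x, y) ↦ (x - y, y)` of `IsShear.map`, where the translation by `1` that brings
`x - y` to the interval `[0, 2]` is compensated by passing to a left neighbour. -/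
def invMap : O'.Surface → O.Surface :=
  lift (fun s x y => O.strip (O.right.symm (σ.symm s)) (x - y + 1) y)
    (fun s y hy => by
      rw [strip_of_ge (by linarith [hy.2]), strip_of_le (by linarith [hy.1]),
        hσ.symm_right, Equiv.apply_symm_apply, Equiv.symm_apply_apply]
      congr 1; ring)
    (fun s x hx => by
      rw [strip_of_le (by linarith [hx.2]), strip_of_ge (by linarith [hx.1]), pt_up,
        Equiv.apply_symm_apply]
      congr 1
      · rw [Equiv.eq_symm_apply, hσ.map_up, ← hσ.map_right, Equiv.apply_symm_apply,
          Equiv.apply_symm_apply]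
      · ring)

theorem map_pt (s : O.Square) {x y : ℝ} (hx : x ∈ Icc (0 : ℝ) 1) (hy : y ∈ Icc (0 : ℝ) 1) :
    hσ.map (O.pt s x y) = O'.strip (σ s) (x + y) y := lift_pt _ _ _ s hx hy

theorem invMap_pt (s : O'.Square) {x y : ℝ} (hx : x ∈ Icc (0 : ℝ) 1) (hy : y ∈ Icc (0 : ℝ) 1) :
    hσ.invMap (O'.pt s x y) = O.strip (O.right.symm (σ.symm s)) (x - y + 1) y :=
  lift_pt _ _ _ s hx hy

theorem leftInverse_invMap : Function.LeftInverse hσ.invMap hσ.map := fun z => by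
  obtain ⟨s, x, hx, y, hy, rfl⟩ := O.exists_eq_pt z
  rw [map_pt _ _ hx hy]
  rcases le_total (x + y) 1 with h | h
  · rw [strip_of_le h, invMap_pt _ _ ⟨by linarith [hx.1, hy.1], h⟩ hy,
      strip_of_ge (by linarith [hx.1]), Equiv.apply_symm_apply, Equiv.symm_apply_apply]
    congr 1; ring
  · rw [strip_of_ge h, invMap_pt _ _ ⟨by linarith, by linarith [hx.2, hy.2]⟩ hy,
      strip_of_le (by linarith [hx.2]), ← hσ.map_right, Equiv.symm_apply_apply,
      Equiv.symm_apply_apply]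
    congr 1; ring

theorem rightInverse_invMap : Function.RightInverse hσ.invMap hσ.map := fun z => by
  obtain ⟨s, x, hx, y, hy, rfl⟩ := O'.exists_eq_pt z
  rw [invMap_pt _ _ hx hy]
  rcases le_total (x - y + 1) 1 with h | h
  · rw [strip_of_le h, map_pt _ _ ⟨by linarith [hx.1, hy.2], h⟩ hy,
      strip_of_ge (by linarith [hx.1]), ← hσ.map_right, Equiv.apply_symm_apply,
      Equiv.apply_symm_apply]
    congr 1; ring
  · rw [strip_of_ge h, map_pt _ _ ⟨by linarith, by linarith [hx.2, hy.1]⟩ hy,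
      strip_of_le (by linarith [hx.2]), Equiv.apply_symm_apply, Equiv.apply_symm_apply]
    congr 1; ring

/-- The affine homeomorphism described by a shear of the squares. -/
def homeomorph : O.Surface ≃ₜ O'.Surface where
  toFun := hσ.map
  invFun := hσ.invMap
  left_inv := hσ.leftInverse_invMap
  right_inv := hσ.rightInverse_invMap
  continuous_toFun := continuous_lift _ _ _ fun s => (O'.continuous_strip (σ s)).comp
    (f := fun p : ℝ × ℝ => (p.1 + p.2, p.2)) (by fun_prop)
  continuous_invFun := continuous_lift _ _ _ fun s =>
    (O.continuous_strip (O.right.symm (σ.symm s))).comp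
      (f := fun p : ℝ × ℝ => (p.1 - p.2 + 1, p.2)) (by fun_prop)

theorem coversLinear_homeomorph : CoversLinear hσ.homeomorph ModularGroup.T := fun z => by
  obtain ⟨s, x, hx, y, hy, rfl⟩ := O.exists_eq_pt z
  change O'.toTorus (hσ.map (O.pt s x y)) = _
  rw [map_pt _ _ hx hy, toTorus_strip _ _ ⟨by linarith [hx.1, hy.1], by linarith [hx.2, hy.2]⟩ hy,
    toTorus_pt _ _ hx hy, ← torusMk_mulVec]
  congr 1
  ext i
  fin_cases i <;> simp [ModularGroup.T, Matrix.mulVec, Matrix.vecHead, Matrix.vecTail]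

end IsShear

/-- A bijection `τ` between the squares of two tilings that describes the rotation by a quarter
turn, `(x, y) ↦ (1 - y, x)` from the square `s` to the square `τ s`. -/
structure IsQuarterTurn (τ : O.Square ≃ O'.Square) : Prop where
  map_right (s : O.Square) : τ (O.right s) = O'.up (τ s)
  right_map_up (s : O.Square) : O'.right (τ (O.up s)) = τ s

namespace IsQuarterTurn

variable {τ : O.Square ≃ O'.Square} (hτ : IsQuarterTurn τ)

/-- The map `(x, y) ↦ (1 - y, x)` from the square `s` to the square `τ s`. -/
def map : O.Surface → O'.Surface :=
  lift (fun s x y => O'.pt (τ s) (1 - y) x)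
    (fun s y _ => by rw [pt_up, hτ.map_right])
    (fun s x _ => by rw [sub_self, sub_zero, pt_right, hτ.right_map_up])

/-- The inverse `(x, y) ↦ (y, 1 - x)` of `IsQuarterTurn.map`. -/
def invMap : O'.Surface → O.Surface :=
  lift (fun s x y => O.pt (τ.symm s) y (1 - x))
    (fun s y _ => by
      rw [sub_self, sub_zero, pt_up]
      congr 1
      rw [Equiv.symm_apply_eq]
      apply O'.right.injective
      rw [hτ.right_map_up, Equiv.apply_symm_apply])
    (fun s x _ => by
      rw [pt_right]
      congr 1
      rw [Equiv.eq_symm_apply, hτ.map_right, Equiv.apply_symm_apply])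

theorem map_pt (s : O.Square) {x y : ℝ} (hx : x ∈ Icc (0 : ℝ) 1) (hy : y ∈ Icc (0 : ℝ) 1) :
    hτ.map (O.pt s x y) = O'.pt (τ s) (1 - y) x := lift_pt _ _ _ s hx hy

theorem invMap_pt (s : O'.Square) {x y : ℝ} (hx : x ∈ Icc (0 : ℝ) 1) (hy : y ∈ Icc (0 : ℝ) 1) :
    hτ.invMap (O'.pt s x y) = O.pt (τ.symm s) y (1 - x) := lift_pt _ _ _ s hx hy

/-- The affine homeomorphism described by a quarter turn of the squares. -/
def homeomorph : O.Surface ≃ₜ O'.Surface where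
  toFun := hτ.map
  invFun := hτ.invMap
  left_inv z := by
    obtain ⟨s, x, hx, y, hy, rfl⟩ := O.exists_eq_pt z
    rw [map_pt _ _ hx hy, invMap_pt _ _ (Icc.one_sub_mem hy) hx,
      Equiv.symm_apply_apply, sub_sub_cancel]
  right_inv z := by
    obtain ⟨s, x, hx, y, hy, rfl⟩ := O'.exists_eq_pt z
    rw [invMap_pt _ _ hx hy, map_pt _ _ hy (Icc.one_sub_mem hx),
      Equiv.apply_symm_apply, sub_sub_cancel]
  continuous_toFun := continuous_lift _ _ _ fun s => (O'.continuous_pt (τ s)).comp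
    (f := fun p : ℝ × ℝ => (1 - p.2, p.1)) (by fun_prop)
  continuous_invFun := continuous_lift _ _ _ fun s => (O.continuous_pt (τ.symm s)).comp
    (f := fun p : ℝ × ℝ => (p.2, 1 - p.1)) (by fun_prop)

theorem coversLinear_homeomorph : CoversLinear hτ.homeomorph ModularGroup.S := fun z => by
  obtain ⟨s, x, hx, y, hy, rfl⟩ := O.exists_eq_pt z
  change O'.toTorus (hτ.map (O.pt s x y)) = _
  rw [map_pt _ _ hx hy, toTorus_pt _ _ (Icc.one_sub_mem hy) hx,
    toTorus_pt _ _ hx hy, ← torusMk_mulVec]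
  ext i
  fin_cases i <;> simp [ModularGroup.S, torusMk_apply]

end IsQuarterTurn

section Regular

variable (O)

/-- The tiling turned by a quarter turn. -/
abbrev quarterTurn : SquareTiling where
  Square := O.Square
  finite := O.finite
  right := O.up⁻¹
  up := O.right

theorem isQuarterTurn_refl : IsQuarterTurn (O' := O.quarterTurn) (Equiv.refl O.Square) where
  map_right _ := rfl
  right_map_up s := O.up.symm_apply_apply s

variable {O}

theorem isRegular_of_fst_mem_Ioo (s : O.Square) {x y : ℝ} (hx : x ∈ Ioo (0 : ℝ) 1)
    (hy : y ∈ Icc (0 : ℝ) 1) : O.IsRegular (O.pt s x y) := by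
  refine O.isQuarterTurn_refl.coversLinear_homeomorph.isRegular_apply_iff.1 ?_
  change IsRegular _ (O.isQuarterTurn_refl.map (O.pt s x y))
  rw [IsQuarterTurn.map_pt _ _ (Ioo_subset_Icc_self hx) hy]
  exact O.quarterTurn.isRegular_of_snd_mem_Ioo s (Icc.one_sub_mem hy) hx

theorem isRegular_of_toTorus_ne_zero {z : O.Surface} (hz : O.toTorus z ≠ 0) : O.IsRegular z := by
  obtain ⟨s, x, hx, y, hy, rfl⟩ := O.exists_eq_pt z
  by_cases hx' : x ∈ Ioo (0 : ℝ) 1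
  · exact isRegular_of_fst_mem_Ioo s hx' hy
  by_cases hy' : y ∈ Ioo (0 : ℝ) 1
  · exact O.isRegular_of_snd_mem_Ioo s hx hy'
  have integer {r : ℝ} (hr : r ∈ Icc (0 : ℝ) 1) (hr' : r ∉ Ioo (0 : ℝ) 1) :
      ∃ n : ℤ, (n : ℝ) = r := by
    rcases hr.1.eq_or_lt with h0 | h0
    · exact ⟨0, by simpa using h0⟩
    · exact ⟨1, by simpa using (hr.2.antisymm (not_lt.1 fun h1 => hr' ⟨h0, h1⟩)).symm⟩
  refine absurd ?_ hz
  rw [toTorus_pt _ _ hx hy, torusMk_eq_zero_iff, Fin.forall_fin_two]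
  exact ⟨integer hx hx', integer hy hy'⟩

end Regular

section Derivative

variable {f : O.Surface ≃ₜ O.Surface} {A : Matrix (Fin 2) (Fin 2) ℝ}

theorem IsAffineWithDerivative.exists_toTorus_eq_add (hf : O.IsAffineWithDerivative f A)
    {α : Type*} [TopologicalSpace α] {γ : α → O.Surface} {v : α → Fin 2 → ℝ} {a : α}
    (hγ : ContinuousAt γ a) (hv : ContinuousAt v a) (hreg : O.IsRegular (γ a))
    (hvγ : ∀ᶠ x in 𝓝 a, O.toTorus (γ x) = torusMk (v x)) :
    ∃ c, ∀ᶠ x in 𝓝 a, O.toTorus (f (γ x)) = torusMk (A.mulVec (v x)) + c := by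
  obtain ⟨φ, hφ, hφa⟩ := hreg
  obtain ⟨ψ, hψ, hψa⟩ := (hf.1 _).2 ⟨φ, hφ, hφa⟩
  obtain ⟨b, hb⟩ := hf.2 φ ψ hφ hψ _ hφa hψa
  have hφγ := hγ.eventually (φ.open_source.mem_nhds hφa)
  have hψγ := (f.continuous.continuousAt.comp hγ).eventually (ψ.open_source.mem_nhds hψa)
  obtain ⟨c, hc⟩ : ∃ c, ∀ᶠ x in 𝓝 a, φ (γ x) = v x + c := by
    refine exists_eventuallyEq_add_of_torusMk_eq ((φ.continuousAt hφa).comp hγ) hv ?_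
    filter_upwards [hφγ, hvγ] with x hx hvx
    exact (hφ _ hx).trans hvx
  refine ⟨torusMk (A.mulVec c + b), ?_⟩
  filter_upwards [hγ.eventually hb, hc, hψγ] with x hbx hcx hψx
  calc O.toTorus (f (γ x)) = torusMk (ψ (f (γ x))) := (hψ _ hψx).symm
    _ = torusMk (A.mulVec (v x)) + torusMk (A.mulVec c + b) := by
      rw [hbx, hcx, Matrix.mulVec_add, add_assoc, map_add]

theorem IsAffineWithDerivative.torusMk_col_eq_zero (hf : O.IsAffineWithDerivative f A) (j : Fin 2)
    {γ : ℝ → O.Surface} (hγ : Continuous γ)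
    (hedge : ∀ t ∈ Ioo (0 : ℝ) 1, O.toTorus (γ t) = torusMk (Pi.single j t))
    (h0 : ¬ O.IsRegular (γ 0)) (h1 : ¬ O.IsRegular (γ 1)) : torusMk (A.col j) = 0 := by
  let v (t : ℝ) : Fin 2 → ℝ := Pi.single j t
  have hv : Continuous v := continuous_single (A := fun _ => ℝ) j
  have hdiff : Continuous fun t => O.toTorus (f (γ t)) - torusMk (A.mulVec (v t)) :=
    (O.continuous_toTorus.comp (f.continuous.comp hγ)).sub
      (continuous_torusMk.comp (continuous_const.matrix_mulVec hv))
  have hreg (t) (ht : t ∈ Ioo (0 : ℝ) 1) : O.IsRegular (γ t) := by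
    refine isRegular_of_toTorus_ne_zero fun hzero => ht.1.ne' ?_
    have hsmall (i : Fin 2) : |v t i| < 1 := by
      rcases eq_or_ne i j with rfl | hij
      · simpa [v, abs_of_pos ht.1] using ht.2
      · simp [v, hij]
    exact Pi.single_eq_zero_iff.1
      (eq_zero_of_torusMk_eq_zero ((hedge t ht).symm.trans hzero) hsmall)
  have hconst : O.toTorus (f (γ 0)) - torusMk (A.mulVec (v 0)) =
      O.toTorus (f (γ 1)) - torusMk (A.mulVec (v 1)) := by
    refine eq_of_eventually_const_Ioo zero_lt_one hdiff fun t ht => ?_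
    obtain ⟨c, hc⟩ := hf.exists_toTorus_eq_add hγ.continuousAt hv.continuousAt (hreg t ht)
      (eventually_of_mem (Ioo_mem_nhds ht.1 ht.2) hedge)
    filter_upwards [hc] with t' ht'
    rw [ht', hc.self_of_nhds, add_sub_cancel_left, add_sub_cancel_left]
  -- An affine homeomorphism preserves the singularities, and these lie over the origin.
  have hsing (z) (hz : ¬ O.IsRegular z) : O.toTorus (f z) = 0 :=
    not_not.1 fun h => hz ((hf.1 z).1 (isRegular_of_toTorus_ne_zero h))
  simpa [v, hsing _ h0, hsing _ h1] using hconst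

theorem IsAffineWithDerivative.exists_eq_map_intCast (hf : O.IsAffineWithDerivative f A)
    {s t : O.Square} (hs : ⁅O.right, O.up⁆ s ≠ s)
    (hs' : ⁅O.right, O.up⁆ (O.right s) ≠ O.right s) (ht : ⁅O.right, O.up⁆ t ≠ t)
    (ht' : ⁅O.right, O.up⁆ (O.up t) ≠ O.up t) :
    ∃ M : Matrix (Fin 2) (Fin 2) ℤ, A = M.map Int.cast := by
  refine exists_eq_map_intCast_of_torusMk_col_eq_zero (Fin.forall_fin_two.2 ⟨?_, ?_⟩)
  · refine hf.torusMk_col_eq_zero 0 (γ := fun x => O.pt s x 0)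
      ((O.continuous_pt s).comp (Continuous.prodMk_left 0)) (fun x hx => ?_)
      (O.not_isRegular_of_commutator_ne hs) ?_
    · rw [toTorus_pt _ _ (Ioo_subset_Icc_self hx) (by simp)]
      congr 1
      ext i
      fin_cases i <;> simp
    · exact (O.pt_right s 0).symm ▸ O.not_isRegular_of_commutator_ne hs'
  · refine hf.torusMk_col_eq_zero 1 (γ := fun y => O.pt t 0 y)
      ((O.continuous_pt t).comp (Continuous.prodMk_right 0)) (fun y hy => ?_)
      (O.not_isRegular_of_commutator_ne ht) ?_
    · rw [toTorus_pt _ _ (by simp) (Ioo_subset_Icc_self hy)]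
      congr 1
      ext i
      fin_cases i <;> simp
    · exact (O.pt_up t 0).symm ▸ O.not_isRegular_of_commutator_ne ht'

end Derivative

theorem veechGroup_eq_range_mapGL {σ τ : Equiv.Perm O.Square} (hσ : IsShear σ)
    (hτ : IsQuarterTurn τ) {s t : O.Square} (hs : ⁅O.right, O.up⁆ s ≠ s)
    (hs' : ⁅O.right, O.up⁆ (O.right s) ≠ O.right s) (ht : ⁅O.right, O.up⁆ t ≠ t)
    (ht' : ⁅O.right, O.up⁆ (O.up t) ≠ O.up t) :
    O.veechGroup = (Matrix.SpecialLinearGroup.mapGL ℝ : SL(2, ℤ) →* GL (Fin 2) ℝ).range := by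
  apply le_antisymm
  · intro A hA
    have integral {B : GL (Fin 2) ℝ} (hB : B ∈ O.veechGroup) :
        ∃ M : Matrix (Fin 2) (Fin 2) ℤ, (B : Matrix (Fin 2) (Fin 2) ℝ) = M.map Int.cast :=
      hB.2.elim fun f hf => hf.exists_eq_map_intCast hs hs' ht ht'
    obtain ⟨M, hM⟩ := integral hA
    obtain ⟨N, hN⟩ := integral (inv_mem hA)
    exact mem_range_mapGL_of_eq_map_intCast hM hN hA.1
  · rw [MonoidHom.range_eq_map, ← SpecialLinearGroup.SL2Z_generators, MonoidHom.map_closure,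
      Subgroup.closure_le]
    rintro _ ⟨g, rfl | rfl, rfl⟩
    · exact hτ.coversLinear_homeomorph.mapGL_mem_veechGroup
    · exact hσ.coversLinear_homeomorph.mapGL_mem_veechGroup

end SquareTiling

/-! ### Cyclic covers -/

namespace SquareTiling

variable {O O' : SquareTiling}

section CyclicCover

variable {n : ℕ} [NeZero n] {d : O.Square → ℤ} {d' : O'.Square → ℤ} {c : O.Square → ℤ}

/-- The lift of a bijection `σ` between the squares of two tilings to cyclic covers that inverts the
deck transformations: the copy `(s, j)` goes to the copy `(σ s, c s - j)`. -/
def coverEquiv (n : ℕ) [NeZero n] (d : O.Square → ℤ) (d' : O'.Square → ℤ) (σ : O.Square ≃ O'.Square)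
    (c : O.Square → ℤ) : (O.cyclicCover n d).Square ≃ (O'.cyclicCover n d').Square :=
  Equiv.prodShear σ fun s => Equiv.subLeft (c s : ZMod n)

theorem IsShear.coverEquiv {σ : O.Square ≃ O'.Square} (hσ : IsShear σ)
    (hr : ∀ s, c (O.right s) - d s = c s + d' (σ s)) (hu : ∀ s, c (O.up s) = c s + d' (σ s)) :
    IsShear (coverEquiv n d d' σ c) where
  map_right := fun (s, j) => Prod.ext (hσ.map_right s) <| by
    have h := congrArg (Int.cast : ℤ → ZMod n) (hr s)
    push_cast at h
    change (c (O.right s) : ZMod n) - (j + d s) = c s - j + d' (σ s)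
    linear_combination h
  map_up := fun (s, j) => Prod.ext (hσ.map_up s) <| by
    have h := congrArg (Int.cast : ℤ → ZMod n) (hu s)
    push_cast at h
    change (c (O.up s) : ZMod n) - j = c s - j + d' (σ s)
    linear_combination h

theorem IsQuarterTurn.coverEquiv {τ : O.Square ≃ O'.Square} (hτ : IsQuarterTurn τ)
    (hr : ∀ s, c (O.right s) = c s + d s) (hu : ∀ s, c s = c (O.up s) + d' (τ (O.up s))) :
    IsQuarterTurn (coverEquiv n d d' τ c) where
  map_right := fun (s, j) => Prod.ext (hτ.map_right s) <| by
    have h := congrArg (Int.cast : ℤ → ZMod n) (hr s)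
    push_cast at h
    change (c (O.right s) : ZMod n) - (j + d s) = c s - j
    linear_combination h
  right_map_up := fun (s, j) => Prod.ext (hτ.right_map_up s) <| by
    have h := congrArg (Int.cast : ℤ → ZMod n) (hu s)
    push_cast at h
    change (c (O.up s) : ZMod n) - j + d' (τ (O.up s)) = c s - j
    linear_combination -h

theorem commutator_cyclicCover_ne {s : O.Square} (h : ⁅O.right, O.up⁆ s ≠ s) (j : ZMod n) :
    ⁅(O.cyclicCover n d).right, (O.cyclicCover n d).up⁆ (s, j) ≠ (s, j) :=
  fun hsj => h (congrArg Prod.fst hsj)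

end CyclicCover

end SquareTiling

/-- The relations `x³ = y³ = (xy)² = 1` of the tetrahedral group, the alternating group of degree
four. -/
structure TetrahedralRelations {G : Type*} [Group G] (x y : G) : Prop where
  pow_three_left : x ^ 3 = 1
  pow_three_right : y ^ 3 = 1
  mul_pow_two : (x * y) ^ 2 = 1

namespace TetrahedralRelations

variable {G : Type*} [Group G] {x y : G} (h : TetrahedralRelations x y)

include h

theorem mul_self_left : x * x = x⁻¹ :=
  eq_inv_of_mul_eq_one_left (by rw [← h.pow_three_left, pow_three'])

theorem mul_self_right : y * y = y⁻¹ :=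
  eq_inv_of_mul_eq_one_left (by rw [← h.pow_three_right, pow_three'])

theorem inv_mul_inv_left : x⁻¹ * x⁻¹ = x := by rw [← mul_inv_rev, h.mul_self_left, inv_inv]

theorem inv_mul_inv_right : y⁻¹ * y⁻¹ = y := by rw [← mul_inv_rev, h.mul_self_right, inv_inv]

theorem mul_eq : x * y = y⁻¹ * x⁻¹ := by
  rw [← mul_inv_rev]
  exact eq_inv_of_mul_eq_one_left (by rw [← pow_two, h.mul_pow_two])

theorem mul_eq' : y * x = x⁻¹ * y⁻¹ := by
  rw [eq_inv_mul_iff_mul_eq, ← mul_assoc, h.mul_eq, inv_mul_cancel_right]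

theorem left_ne_one (hy : y ≠ 1) : x ≠ 1 := by
  rintro rfl
  exact hy (by rw [← inv_eq_one, ← h.mul_self_right, ← pow_two, ← one_mul y, h.mul_pow_two])

theorem mul_inv_sq_ne_one (hy : y ≠ 1) : x * y⁻¹ * x * y⁻¹ ≠ 1 := fun hxy => by
  have h₁ : x * y⁻¹ * x = y := by rw [mul_eq_one_iff_eq_inv.1 hxy, inv_inv]
  have h₂ : y⁻¹ * x = x⁻¹ * y := by rw [eq_inv_mul_iff_mul_eq, ← mul_assoc, h₁]
  have h₃ : x * y⁻¹ = x * y := calc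
    x * y⁻¹ = y * x⁻¹ := eq_mul_inv_of_mul_eq h₁
    _ = x⁻¹ * (y⁻¹ * x) := by rw [← mul_assoc, ← h.mul_eq', mul_assoc, h.mul_self_left]
    _ = x * y := by rw [h₂, ← mul_assoc, h.inv_mul_inv_left]
  exact hy <| calc
    y = y⁻¹ * y⁻¹ := h.inv_mul_inv_right.symm
    _ = y⁻¹ * y := by rw [mul_left_cancel h₃]
    _ = 1 := inv_mul_cancel y

end TetrahedralRelations

/-! ### Origamis from tetrahedral relations -/

section GroupOrigami

variable {G : Type} [Group G]

/-- The construction of the origami `X` from an arbitrary finite group with two distinguished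
elements `x` and `y` in place of `PΓ₂ / PΓ₆`. -/
def groupOrigami [Finite G] (x y : G) : SquareTiling where
  Square := G × Fin 4
  finite := inferInstance
  right :=
    { toFun := fun s => match s with
        | (A, 0) => (A, 1)
        | (A, 1) => (A * y⁻¹, 0)
        | (A, 2) => (A, 3)
        | (A, 3) => (A * y, 2)
      invFun := fun s => match s with
        | (A, 0) => (A * y, 1)
        | (A, 1) => (A, 0)
        | (A, 2) => (A * y⁻¹, 3)
        | (A, 3) => (A, 2)
      left_inv := by rintro ⟨A, h⟩; fin_cases h <;> simp
      right_inv := by rintro ⟨A, h⟩; fin_cases h <;> simp }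
  up :=
    { toFun := fun s => match s with
        | (A, 0) => (A * y, 2)
        | (A, 1) => (A * y⁻¹, 3)
        | (A, 2) => (A * x⁻¹, 0)
        | (A, 3) => (A * x, 1)
      invFun := fun s => match s with
        | (A, 0) => (A * x, 2)
        | (A, 1) => (A * x⁻¹, 3)
        | (A, 2) => (A * y⁻¹, 0)
        | (A, 3) => (A * y, 1)
      left_inv := by rintro ⟨A, h⟩; fin_cases h <;> simp
      right_inv := by rintro ⟨A, h⟩; fin_cases h <;> simp }

/-- The permutation of the squares of `groupOrigami x y` induced by the shear `T`. -/
def groupShear (y : G) : Equiv.Perm (G × Fin 4) where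
  toFun s := match s with
    | (A, 0) => (A * y⁻¹, 1)
    | (A, 1) => (A * y, 0)
    | (A, 2) => (A * y, 2)
    | (A, 3) => (A * y, 3)
  invFun s := match s with
    | (A, 0) => (A * y⁻¹, 1)
    | (A, 1) => (A * y, 0)
    | (A, 2) => (A * y⁻¹, 2)
    | (A, 3) => (A * y⁻¹, 3)
  left_inv := by rintro ⟨A, h⟩; fin_cases h <;> simp
  right_inv := by rintro ⟨A, h⟩; fin_cases h <;> simp

/-- The permutation of the squares of `groupOrigami x y` induced by the quarter turn `S`. -/
def groupQuarterTurn (x : G) : Equiv.Perm (G × Fin 4) where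
  toFun s := match s with
    | (A, 0) => (A * x⁻¹, 2)
    | (A, 1) => (A * x, 0)
    | (A, 2) => (A * x, 3)
    | (A, 3) => (A * x⁻¹, 1)
  invFun s := match s with
    | (A, 0) => (A * x⁻¹, 1)
    | (A, 1) => (A * x, 3)
    | (A, 2) => (A * x, 0)
    | (A, 3) => (A * x⁻¹, 2)
  left_inv := by rintro ⟨A, h⟩; fin_cases h <;> simp
  right_inv := by rintro ⟨A, h⟩; fin_cases h <;> simp

/-- The drift on the squares of `groupOrigami x y` with potential `p : G → ℤ`: apart from the sign
that depends on the height, it is the increment of `p` along right multiplication by `x⁻¹`. -/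
def potentialDrift (x : G) (p : G → ℤ) : G × Fin 4 → ℤ
  | (A, 0) => p A - p (A * x⁻¹)
  | (A, 2) => p (A * x⁻¹) - p A
  | (_, 1) => 0
  | (_, 3) => 0

/-- The shift of the copies in the lift of `groupShear y` to the cyclic cover with drift
`potentialDrift x p`. -/
def shearShift (x y : G) (p : G → ℤ) : G × Fin 4 → ℤ
  | (A, 0) => -p A
  | (A, 1) => -p (A * x⁻¹)
  | (A, 2) => -p (A * y⁻¹)
  | (A, 3) => -p A

/-- The shift of the copies in the lift of `groupQuarterTurn x` to the cyclic cover with drift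
`potentialDrift x p`. -/
def quarterTurnShift (x : G) (p : G → ℤ) : G × Fin 4 → ℤ
  | (A, 0) => p (A * x⁻¹)
  | (A, 1) => p A
  | (A, 2) => p A
  | (A, 3) => p (A * x⁻¹)

variable {x y : G} [Finite G]

namespace TetrahedralRelations

variable (h : TetrahedralRelations x y)

include h

theorem isShear_groupShear :
    SquareTiling.IsShear (O := groupOrigami x y) (O' := groupOrigami x y) (groupShear y) where
  map_right := fun
    | (_, 0) => congrArg (·, 0) (by rw [mul_assoc, h.inv_mul_inv_right])
    | (_, 1) => congrArg (·, 1) (by rw [mul_assoc, h.inv_mul_inv_right])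
    | (_, 2) => rfl
    | (_, 3) => rfl
  map_up := fun
    | (_, 0) => congrArg (·, 2) (by rw [mul_assoc, h.mul_self_right, inv_mul_cancel_right])
    | (_, 1) => congrArg (·, 3) (by rw [inv_mul_cancel_right, mul_inv_cancel_right])
    | (_, 2) => congrArg (·, 1) (by rw [mul_assoc, ← h.mul_eq', mul_assoc])
    | (_, 3) => congrArg (·, 0) (by
        rw [mul_assoc, h.mul_eq, mul_assoc _ y y, h.mul_self_right, mul_assoc])

theorem isQuarterTurn_groupQuarterTurn :
    SquareTiling.IsQuarterTurn (O := groupOrigami x y) (O' := groupOrigami x y)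
      (groupQuarterTurn x) where
  map_right := fun
    | (_, 0) => congrArg (·, 0) (by rw [mul_assoc, h.inv_mul_inv_left])
    | (_, 1) => congrArg (·, 2) (by rw [mul_assoc, ← h.mul_eq, mul_assoc])
    | (_, 2) => congrArg (·, 1) (by rw [mul_assoc, h.mul_self_left])
    | (_, 3) => congrArg (·, 3) (by rw [mul_assoc, h.mul_eq', mul_assoc])
  right_map_up := fun
    | (_, 0) => congrArg (·, 2) (by
        rw [mul_assoc _ y x, h.mul_eq', ← mul_assoc, inv_mul_cancel_right])
    | (_, 1) => congrArg (·, 0) (by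
        rw [mul_assoc _ y⁻¹ x⁻¹, ← h.mul_eq, ← mul_assoc, mul_inv_cancel_right])
    | (_, 2) => congrArg (·, 3) (by rw [mul_assoc, h.inv_mul_inv_left])
    | (_, 3) => congrArg (·, 1) (by rw [mul_assoc, h.mul_self_left])

theorem groupOrigami_commutator_zero_ne (hy : y ≠ 1) (A : G) :
    ⁅(groupOrigami x y).right, (groupOrigami x y).up⁆ (A, 0) ≠ (A, 0) := fun e =>
  h.mul_inv_sq_ne_one hy <| by
    have key : A * x * y⁻¹ * x * y⁻¹ = A := congrArg Prod.fst e
    simpa only [mul_assoc, mul_eq_left] using key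

theorem groupOrigami_commutator_one_ne (hy : y ≠ 1) (A : G) :
    ⁅(groupOrigami x y).right, (groupOrigami x y).up⁆ (A, 1) ≠ (A, 1) := fun e =>
  h.left_ne_one hy <| by
    have key : A * x⁻¹ * x⁻¹ = A := congrArg Prod.fst e
    rwa [mul_assoc, h.inv_mul_inv_left, mul_eq_left] at key

theorem groupOrigami_commutator_three_ne (hy : y ≠ 1) (A : G) :
    ⁅(groupOrigami x y).right, (groupOrigami x y).up⁆ (A, 3) ≠ (A, 3) := fun e =>
  hy <| by
    have key : A * y * y = A := congrArg Prod.fst e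
    rwa [mul_assoc, h.mul_self_right, mul_eq_left, inv_eq_one] at key

variable {n : ℕ} [NeZero n] {p : G → ℤ} (hp : ∀ A, p (A * x⁻¹) = p (A * y))

include hp

theorem isShear_coverEquiv_groupShear :
    SquareTiling.IsShear (SquareTiling.coverEquiv (O := groupOrigami x y)
      (O' := groupOrigami x y) n (potentialDrift x p) (potentialDrift x p) (groupShear y)
      (shearShift x y p)) := by
  have hy (A : G) : p (A * y * x⁻¹) = p (A * y⁻¹) := by rw [hp, mul_assoc, h.mul_self_right]
  refine h.isShear_groupShear.coverEquiv (fun (A, i) => ?_) (fun (A, i) => ?_)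
  · match i with
    | 0 => change -p (A * x⁻¹) - (p A - p (A * x⁻¹)) = -p A + 0; ring
    | 1 => change -p (A * y⁻¹) - 0 = -p (A * x⁻¹) + (p (A * y) - p (A * y * x⁻¹)); rw [hp, hy]; ring
    | 2 => change -p A - (p (A * x⁻¹) - p A) = -p (A * y⁻¹) + (p (A * y * x⁻¹) - p (A * y))
           rw [hp, hy]; ring
    | 3 => change -p (A * y * y⁻¹) - 0 = -p A + 0; rw [mul_inv_cancel_right]; ring
  · match i with
    | 0 => change -p (A * y * y⁻¹) = -p A + 0; rw [mul_inv_cancel_right]; ring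
    | 1 => change -p (A * y⁻¹) = -p (A * x⁻¹) + (p (A * y) - p (A * y * x⁻¹)); rw [hp, hy]; ring
    | 2 => change -p (A * x⁻¹) = -p (A * y⁻¹) + (p (A * y * x⁻¹) - p (A * y))
           rw [hp, hy]; ring
    | 3 => change -p (A * x * x⁻¹) = -p A + 0; rw [mul_inv_cancel_right]; ring

theorem isQuarterTurn_coverEquiv_groupQuarterTurn :
    SquareTiling.IsQuarterTurn (SquareTiling.coverEquiv (O := groupOrigami x y)
      (O' := groupOrigami x y) n (potentialDrift x p) (potentialDrift x p) (groupQuarterTurn x)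
      (quarterTurnShift x p)) := by
  refine h.isQuarterTurn_groupQuarterTurn.coverEquiv (fun (A, i) => ?_) (fun (A, i) => ?_)
  · match i with
    | 0 => change p A = p (A * x⁻¹) + (p A - p (A * x⁻¹)); ring
    | 1 => change p (A * y⁻¹ * x⁻¹) = p A + 0; rw [hp, inv_mul_cancel_right, add_zero]
    | 2 => change p (A * x⁻¹) = p A + (p (A * x⁻¹) - p A); ring
    | 3 => change p (A * y) = p (A * x⁻¹) + 0; rw [hp, add_zero]
  · match i with
    | 0 => change p (A * x⁻¹) = p (A * y) + 0; rw [hp, add_zero]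
    | 1 => change p A = p (A * y⁻¹ * x⁻¹) + 0; rw [hp, inv_mul_cancel_right, add_zero]
    | 2 => change p A = p (A * x⁻¹ * x⁻¹) + (p (A * x⁻¹ * x⁻¹ * x⁻¹) - p (A * x⁻¹ * x⁻¹))
           rw [mul_assoc _ x⁻¹ x⁻¹, h.inv_mul_inv_left, mul_inv_cancel_right]; ring
    | 3 => change p (A * x⁻¹) = p (A * x) + (p (A * x * x) - p (A * x * x * x⁻¹))
           rw [mul_inv_cancel_right, mul_assoc, h.mul_self_left]; ring

end TetrahedralRelations

end GroupOrigami

theorem mainTheorem6_general {G : Type} [Group G] [Finite G] {x y : G}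
    (h : TetrahedralRelations x y) (hy : y ≠ 1) {p : G → ℤ} (hp : ∀ A, p (A * x⁻¹) = p (A * y))
    (n : ℕ) [NeZero n] :
    ((groupOrigami x y).cyclicCover n (potentialDrift x p)).veechGroup =
      (Matrix.SpecialLinearGroup.mapGL ℝ : SL(2, ℤ) →* GL (Fin 2) ℝ).range :=
  have ne_zero (A : G) := h.groupOrigami_commutator_zero_ne hy A
  have ne_one (A : G) := h.groupOrigami_commutator_one_ne hy A
  have ne_three (A : G) := h.groupOrigami_commutator_three_ne hy A
  SquareTiling.veechGroup_eq_range_mapGL (h.isShear_coverEquiv_groupShear hp)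
    (h.isQuarterTurn_coverEquiv_groupQuarterTurn hp) (s := ((1, 0), 0)) (t := ((1, 1), 0))
    (SquareTiling.commutator_cyclicCover_ne (ne_zero _) _)
    (SquareTiling.commutator_cyclicCover_ne (ne_one _) _)
    (SquareTiling.commutator_cyclicCover_ne (ne_one _) _)
    (SquareTiling.commutator_cyclicCover_ne (ne_three _) _)

section Slits

variable {G : Type*} [Group G] {x y : G}

/-- The potential of the slits: the drift of `origamiY` is `potentialDrift x (slitPotential x y)`
for the classes `x` and `y` in `PΓ₂ / PΓ₆`. -/
def slitPotential (x y : G) : G → ℤ :=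
  indicator {y⁻¹, y * x⁻¹} 1

theorem slitPotential_mul_inv (A : G) :
    slitPotential x y (A * x⁻¹) = indicator {y⁻¹ * x, y} 1 A := by
  classical
  simp only [slitPotential, indicator_apply, mem_insert_iff, mem_singleton_iff,
    mul_inv_eq_iff_eq_mul, inv_mul_cancel_right, Pi.one_apply]

namespace TetrahedralRelations

variable (h : TetrahedralRelations x y)

include h

theorem slitPotential_mul (A : G) :
    slitPotential x y (A * y) = indicator {y⁻¹ * x, y} 1 A := by
  classical
  have h₁ : y⁻¹ * y⁻¹ = y := h.inv_mul_inv_right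
  have h₂ : y * x⁻¹ * y⁻¹ = y⁻¹ * x := by
    rw [mul_assoc, ← h.mul_eq', ← mul_assoc, h.mul_self_right]
  simp only [slitPotential, indicator_apply, mem_insert_iff, mem_singleton_iff,
    ← eq_mul_inv_iff_mul_eq, h₁, h₂, or_comm, Pi.one_apply]

theorem slitPotential_mul_inv_eq (A : G) :
    slitPotential x y (A * x⁻¹) = slitPotential x y (A * y) :=
  (slitPotential_mul_inv A).trans (h.slitPotential_mul A).symm

theorem disjoint_slits (hy : y ≠ 1) :
    Disjoint ({y⁻¹, y * x⁻¹} : Set G) {y⁻¹ * x, y} := by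
  have hx : x ≠ 1 := h.left_ne_one hy
  have inv_ne : y⁻¹ ≠ y := fun e => hy (mul_eq_left.1 (h.mul_self_right.trans e))
  have mul_inv_ne : y⁻¹ * x ≠ y * x⁻¹ := fun e => hy <| by
    rwa [← h.mul_self_right, mul_assoc, h.mul_eq', mul_right_inj, mul_eq_left, inv_eq_one] at e
  simp [hx, inv_ne.symm, mul_inv_ne]

end TetrahedralRelations

end Slits

/-! ### The group `PΓ₂ / PΓ₆` -/

section CongruenceQuotient

instance : Finite PGammaQuot := finite_PGammaQuot

theorem origamiX_eq_groupOrigami : origamiX = groupOrigami xQ yQ := by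
  have right_eq : origamiX.right = (groupOrigami xQ yQ).right :=
    Equiv.ext fun (_, i) => by fin_cases i <;> rfl
  have up_eq : origamiX.up = (groupOrigami xQ yQ).up :=
    Equiv.ext fun (_, i) => by fin_cases i <;> rfl
  exact congrArg₂ (SquareTiling.mk (PGammaQuot × Fin 4) _) right_eq up_eq

theorem mem_center_iff_eq_one_or_neg_one {g : SL(2, ℤ)} :
    g ∈ Subgroup.center SL(2, ℤ) ↔ g = 1 ∨ g = -1 := by
  simp only [Matrix.SpecialLinearGroup.mem_center_iff, Fintype.card_fin, sq_eq_one_iff]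
  constructor
  · rintro ⟨r, rfl | rfl, h⟩
    · exact Or.inl (Subtype.ext (by rw [← h]; simp))
    · exact Or.inr (Subtype.ext (by rw [← h]; simp))
  · rintro (rfl | rfl)
    exacts [⟨1, by simp, by simp⟩, ⟨-1, by simp, by simp⟩]

theorem mk_mem_PGamma_iff {N : ℕ} {g : SL(2, ℤ)} :
    (QuotientGroup.mk' (Subgroup.center SL(2, ℤ)) g ∈ PGamma N) ↔
      g ∈ CongruenceSubgroup.Gamma N ∨ -g ∈ CongruenceSubgroup.Gamma N := by
  simp only [PGamma, Subgroup.mem_map, QuotientGroup.mk'_eq_mk', mem_center_iff_eq_one_or_neg_one]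
  constructor
  · rintro ⟨a, ha, z, rfl | rfl, rfl⟩
    · exact Or.inl (by simpa using ha)
    · exact Or.inr (by simpa using ha)
  · rintro (h | h)
    exacts [⟨g, h, 1, by simp⟩, ⟨-g, h, -1, by simp⟩]

/-- The class in `PΓ₂ / PΓ₆` of an element of `Γ₂`. -/
def quotClass : CongruenceSubgroup.Gamma 2 →* PGammaQuot :=
  (QuotientGroup.mk' _).comp (MonoidHom.subgroupMap (QuotientGroup.mk' _) _)

theorem quotClass_eq_one_iff {g : CongruenceSubgroup.Gamma 2} :
    quotClass g = 1 ↔ (g : SL(2, ℤ)) ∈ CongruenceSubgroup.Gamma 6 ∨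
      -(g : SL(2, ℤ)) ∈ CongruenceSubgroup.Gamma 6 :=
  (QuotientGroup.eq_one_iff _).trans mk_mem_PGamma_iff

theorem quotClass_xMat : quotClass ⟨xMat, xMat_mem⟩ = xQ := rfl

theorem quotClass_yMat : quotClass ⟨yMat, yMat_mem⟩ = yQ := rfl

theorem yQ_ne_one : yQ ≠ 1 := by
  rw [← quotClass_yMat, Ne, quotClass_eq_one_iff, CongruenceSubgroup.Gamma_mem,
    CongruenceSubgroup.Gamma_mem]
  decide

theorem tetrahedralRelations_xQ_yQ : TetrahedralRelations xQ yQ where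
  pow_three_left := by
    rw [← quotClass_xMat, ← map_pow, quotClass_eq_one_iff, CongruenceSubgroup.Gamma_mem,
      CongruenceSubgroup.Gamma_mem]
    decide
  pow_three_right := by
    rw [← quotClass_yMat, ← map_pow, quotClass_eq_one_iff, CongruenceSubgroup.Gamma_mem,
      CongruenceSubgroup.Gamma_mem]
    decide
  mul_pow_two := by
    rw [← quotClass_xMat, ← quotClass_yMat, ← map_mul, ← map_pow, quotClass_eq_one_iff,
      CongruenceSubgroup.Gamma_mem, CongruenceSubgroup.Gamma_mem]
    decide

theorem slitDrift_eq_potentialDrift : slitDrift = potentialDrift xQ (slitPotential xQ yQ) := by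
  classical
  have disjoint := disjoint_left.1 (tetrahedralRelations_xQ_yQ.disjoint_slits yQ_ne_one)
  simp only [mem_insert_iff, mem_singleton_iff] at disjoint
  have potential_apply (A : PGammaQuot) :
      slitPotential xQ yQ A = if A = yQ⁻¹ ∨ A = yQ * xQ⁻¹ then 1 else 0 := by
    simp only [slitPotential, indicator_apply, mem_insert_iff, mem_singleton_iff,
      Pi.one_apply]
  have potential_mul_inv (A : PGammaQuot) :
      slitPotential xQ yQ (A * xQ⁻¹) = if A = yQ⁻¹ * xQ ∨ A = yQ then 1 else 0 := by
    simp only [slitPotential_mul_inv, indicator_apply, mem_insert_iff,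
      mem_singleton_iff, Pi.one_apply]
  funext (A, i)
  fin_cases i <;> grind [slitDrift, potentialDrift]

theorem origamiY_eq_cyclicCover (k : ℕ) [NeZero k] :
    origamiY k = (groupOrigami xQ yQ).cyclicCover (2 * k)
      (potentialDrift xQ (slitPotential xQ yQ)) := by
  rw [← slitDrift_eq_potentialDrift, origamiY]
  congr 1
  exact origamiX_eq_groupOrigami

end CongruenceQuotient

end

/-- The Veech group of `Y` is `SL₂(ℤ)`, embedded in `GL₂(ℝ)`. -/
theorem mainTheorem6 (k : ℕ) [NeZero k] :
    (origamiY k).veechGroup = (Matrix.SpecialLinearGroup.mapGL ℝ : SL(2, ℤ) →* GL (Fin 2) ℝ).range := by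
  rw [origamiY_eq_cyclicCover]
  exact mainTheorem6_general tetrahedralRelations_xQ_yQ yQ_ne_one
    tetrahedralRelations_xQ_yQ.slitPotential_mul_inv_eq (2 * k)
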